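/- Let $\Omega\subseteq\mathbb R^2$ be open and star-shaped with respect to the origin, let $\delta\in C^\infty(\Omega)$ be positive and let $\tau\in C^2(\Omega)$. Let $M=(\Omega,\ \delta^{-2}(dx^2+dy^2))$, let $$\mathbf C_{\delta,\tau}(x,y)=2\int_0^1 t\,\frac{\tau(tx,ty)}{\delta(tx,ty)^2}\,dt ,$$ and let the GBCV spacetime $\mathbb L^3(M,\tau)$ be $\Omega\times\mathbb R$ with the Lorentzian metric $$\delta^{-2}(dx^2+dy^2)-\bigl(dz-\mathbf C_{\delta,\tau}(x,y)\,(y\,dx-x\,dy)\bigr)^2 .$$ Let $n\in\{1,2,\dots\}\cup\{\infty\}$ and let $f:\Sigma\to\mathbb L^3(M,\tau)$ be a complete spacelike surface of class $C^n$: $\Sigma$ is a connected Hausdorff $2$-manifold without boundary of class $C^n$, $f$ is a $C^n$ map, the metric induced on $\Sigma$ by $f$ is positive definite (so that $f$ is an immersion), and $\Sigma$ is complete for the Riemannian distance of this induced metric. Then $\Sigma$ is an entire graph, that is, $f$ is an embedding and there is a function $u\in C^n(\Omega)$ with $$f(\Sigma)=\{(x,y,z):\ (x,y)\in\Omega,\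 z=u(x,y)\};$$ moreover, the Riemannian surface $M$ is complete. -/

import Mathlib

open Set Filter Topology Manifold
open scoped ENNReal ContDiff

noncomputable section

/-- The plane `ℝ²` with coordinates `(x, y) = (p 0, p 1)` and its Euclidean structure. -/
abbrev Plane : Type := EuclideanSpace ℝ (Fin 2)

/-- The conformal metric `δ⁻² (dx² + dy²)` on the base, at the point `p`. -/
def baseMetric (δ : Plane → ℝ) (p v w : Plane) : ℝ :=
  (v 0 * w 0 + v 1 * w 1) / δ p ^ 2

/-- The Calabi potential `C(p) = 2 ∫₀¹ t τ(tp) / δ(tp)² dt`. -/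
def calabiPotential (δ τ : Plane → ℝ) (p : Plane) : ℝ :=
  2 * ∫ t in (0 : ℝ)..1, t * (τ (t • p) / δ (t • p) ^ 2)

/-- The one-form `dz - C(x, y) (y dx - x dy)` at the point `p = ((x, y), z)`. -/
def verticalForm (δ τ : Plane → ℝ) (p v : Plane × ℝ) : ℝ :=
  v.2 - calabiPotential δ τ p.1 * (p.1 1 * v.1 0 - p.1 0 * v.1 1)

/-- The Lorentzian metric `δ⁻² (dx² + dy²) - (dz - C(x, y) (y dx - x dy))²` of the GBCV spacetime,
at the point `p`. -/
def spacetimeMetric (δ τ : Plane → ℝ) (p v w : Plane × ℝ) : ℝ :=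
  baseMetric δ p.1 v.1 w.1 - verticalForm δ τ p v * verticalForm δ τ p w

section Surface

variable {F : Type*} [NormedAddCommGroup F] [NormedSpace ℝ F]
  {S : Type*} [TopologicalSpace S] [ChartedSpace Plane S]

/-- The pull-back `f^* g` to a surface `S` of a field `g` of bilinear forms on `F`
along a map `f : S → F`. -/
def inducedMetric (g : F → F → F → ℝ) (f : S → F) (x : S)
    (v w : TangentSpace 𝓘(ℝ, Plane) x) : ℝ :=
  g (f x) (mfderiv 𝓘(ℝ, Plane) 𝓘(ℝ, F) f x v) (mfderiv 𝓘(ℝ, Plane) 𝓘(ℝ, F) f x w)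

/-- The induced metric `f^* g` is Riemannian, i.e. positive definite at every point. -/
def IsRiemannianInduced (g : F → F → F → ℝ) (f : S → F) : Prop :=
  ∀ (x : S) (v : TangentSpace 𝓘(ℝ, Plane) x), v ≠ 0 → 0 < inducedMetric g f x v v

/-- The Riemannian distance on `S` of the induced metric `f^* g`: the infimum of the
lengths of the `C^1` paths in `S` between two points. -/
def inducedEDist (g : F → F → F → ℝ) (f : S → F) (x y : S) : ℝ≥0∞ :=
  letI : ∀ z : S, ENorm (TangentSpace 𝓘(ℝ, Plane) z) :=
    fun z => ⟨fun v => ENNReal.ofReal (Real.sqrt (inducedMetric g f z v v))⟩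
  riemannianEDist 𝓘(ℝ, Plane) x y

/-- Metric completeness of the induced metric `f^* g`: every Cauchy sequence for the Riemannian
distance converges. -/
def IsCompleteInduced (g : F → F → F → ℝ) (f : S → F) : Prop :=
  ∀ a : ℕ → S,
    (∀ ε : ℝ≥0∞, 0 < ε → ∃ N : ℕ, ∀ m ≥ N, ∀ n ≥ N, inducedEDist g f (a m) (a n) < ε) →
    ∃ x : S, Tendsto (fun n => inducedEDist g f (a n) x) atTop (𝓝 0)

/-- The surface `f : S → Ω × ℝ` is the entire graph of a function `u` of class `C^n` on `Ω`:
it is embedded and its image is `{(p, z) : p ∈ Ω, z = u p}`. -/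
def IsEntireGraph (Ω : Set Plane) (n : WithTop ℕ∞) (f : S → Plane × ℝ) : Prop :=
  IsEmbedding f ∧
    ∃ u : Plane → ℝ, ContDiffOn ℝ n u Ω ∧ range f = {q | q.1 ∈ Ω ∧ q.2 = u q.1}

end Surface

/-- The base surface `M = (Ω, δ⁻² (dx² + dy²))` is complete; here `Ω` carries the metric induced
by the inclusion in the plane. -/
def IsCompleteBase (Ω : TopologicalSpace.Opens Plane) (δ : Plane → ℝ) : Prop :=
  IsCompleteInduced (baseMetric δ) (Subtype.val : Ω → Plane)

end

/-! Let `p` be the projection `x ↦ (f x).1` to `Ω`. The spacetime metric is the base metric minus a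
square. So a tangent vector of the surface killed by `dp` would have nonpositive square norm, which
spacelikeness forbids unless it vanishes: `p` is a local diffeomorphism (`isLocalDiffeomorph_fst`).
For the same reason a lift through `p` is never longer than the base curve it covers.

A partial lift of a segment of `Ω` is therefore Lipschitz for the induced distance, and completeness
of the surface gives it an endpoint; hence segments lift (`exists_lift_segment`). Lifting the rays
from the origin gives a continuous section of `p` over the star-shaped set `Ω`. Its image is clopen,
so by connectedness it is the whole surface and `p` is a bijection onto `Ω`
(`IsLocalHomeomorph.injective_and_range_eq_of_starConvex`). The height of `f` over this section is
`u`.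

The section does not increase distances (`inducedEDist_section_le`), so a Cauchy sequence of the
base lifts to a Cauchy sequence of the surface, and the limit upstairs projects to a limit in the
base.

Completeness speaks of the induced distance, whereas lifting needs limits in the manifold topology.
The bridge is `exists_inducedEDist_lt_subset`: near a point the induced metric dominates a multiple
of the Euclidean one, by compactness and continuity of its coefficients, the Calabi potential
included. -/

noncomputable section

/-! ### Lifting paths and star-convex sets through local homeomorphisms -/

section Lifting

variable {X S : Type*} [TopologicalSpace X] [TopologicalSpace S] {p : S → X}

/-- A lift of `c` to `[0, a]` through a local homeomorphism extends past `a`. -/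
theorem IsLocalHomeomorph.exists_lift_extend (hp : IsLocalHomeomorph p) {c : ℝ → X}
    (hc : Continuous c) {a : ℝ} (ha : 0 ≤ a) {γ : ℝ → S} (hγ : ContinuousOn γ (Icc 0 a))
    (hlift : ∀ t ∈ Icc 0 a, p (γ t) = c t) :
    ∃ b > a, ∃ γ' : ℝ → S, ContinuousOn γ' (Icc 0 b) ∧ γ' 0 = γ 0 ∧
      ∀ t ∈ Icc 0 b, p (γ' t) = c t := by
  obtain ⟨e, he, hpe⟩ := hp (γ a)
  have hca : c a ∈ e.target := by
    rw [← hlift a ⟨ha, le_rfl⟩, hpe]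
    exact e.map_source he
  have hnear : ∀ᶠ t in 𝓝 a, c t ∈ e.target :=
    hc.continuousAt.eventually_mem (e.open_target.mem_nhds hca)
  obtain ⟨ε, hε, hball⟩ := Metric.eventually_nhds_iff.1 hnear
  have hmem : ∀ t ∈ Icc a (a + ε / 2), c t ∈ e.target := by
    rintro t ⟨h1, h2⟩
    apply hball
    rw [Real.dist_eq, abs_of_nonneg (by linarith)]
    linarith
  have heq : e.symm (c a) = γ a := by
    rw [← hlift a ⟨ha, le_rfl⟩, hpe, e.left_inv he]
  refine ⟨a + ε / 2, by linarith, fun t ↦ if t ≤ a then γ t else e.symm (c t), ?_, by simp [ha], ?_⟩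
  · rw [← Icc_union_Icc_eq_Icc ha (by linarith : a ≤ a + ε / 2)]
    apply ContinuousOn.union_of_isClosed _ _ isClosed_Icc isClosed_Icc
    · exact hγ.congr fun t ht ↦ by simp [ht.2]
    · refine (e.continuousOn_symm.comp hc.continuousOn hmem).congr fun t ht ↦ ?_
      rcases ht.1.eq_or_lt with rfl | h
      · simp [heq]
      · simp [h]
  · rintro t ⟨h1, h2⟩
    by_cases h : t ≤ a
    · simp [h, hlift t ⟨h1, h⟩]
    · simp only [h, if_false]
      rw [hpe, e.right_inv (hmem t ⟨(not_le.1 h).le, h2⟩)]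

/-- A path lifts through a local homeomorphism if partial lifts have limits at their endpoints. -/
theorem IsLocalHomeomorph.exists_lift_of_tendsto [T2Space X] [T2Space S]
    (hp : IsLocalHomeomorph p)
    {c : ℝ → X} (hc : Continuous c) {x₀ : S} (hx₀ : p x₀ = c 0)
    (hlim : ∀ T ∈ Ioc (0 : ℝ) 1, ∀ γ : ℝ → S, ContinuousOn γ (Ico 0 T) →
      (∀ t ∈ Ico 0 T, p (γ t) = c t) → ∃ x, Tendsto γ (𝓝[<] T) (𝓝 x)) :
    ∃ γ : ℝ → S, ContinuousOn γ (Icc 0 1) ∧ γ 0 = x₀ ∧ ∀ t ∈ Icc (0 : ℝ) 1, p (γ t) = c t := by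
  -- Continuity method: the supremum `T` of the times up to which a lift exists belongs to `A`, and
  -- a lift to `[0, T]` with `T < 1` could be extended.
  let A : Set ℝ := {a | a ∈ Icc (0 : ℝ) 1 ∧ ∃ γ : ℝ → S, ContinuousOn γ (Icc 0 a) ∧ γ 0 = x₀ ∧
    ∀ t ∈ Icc 0 a, p (γ t) = c t}
  have hA0 : (0 : ℝ) ∈ A := by
    refine ⟨by simp, fun _ ↦ x₀, continuousOn_const, rfl, fun t ht ↦ ?_⟩
    obtain rfl : t = 0 := le_antisymm ht.2 ht.1
    exact hx₀
  have hAbdd : BddAbove A := ⟨1, fun a ha ↦ ha.1.2⟩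
  set T := sSup A with hT
  have hT0 : 0 ≤ T := le_csSup hAbdd hA0
  have hT1 : T ≤ 1 := csSup_le ⟨0, hA0⟩ fun a ha ↦ ha.1.2
  suffices hTA : T ∈ A by
    rcases hT1.eq_or_lt with h | h
    · rw [h] at hTA
      exact hTA.2
    · exfalso
      obtain ⟨-, γ, hγ, hγ0, hlift⟩ := hTA
      obtain ⟨b, hb, γ', hγ', hγ'0, hlift'⟩ := hp.exists_lift_extend hc hT0 hγ hlift
      have hmem : min b 1 ∈ A := by
        refine ⟨⟨le_min (hT0.trans hb.le) zero_le_one, min_le_right _ _⟩, γ',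
          hγ'.mono (Icc_subset_Icc_right (min_le_left _ _)), hγ'0.trans hγ0, fun t ht ↦
          hlift' t ⟨ht.1, ht.2.trans (min_le_left _ _)⟩⟩
      exact absurd (le_csSup hAbdd hmem) (not_le.2 (lt_min hb h))
  rcases hT0.eq_or_lt with h | hTpos
  · rw [← h]; exact hA0
  -- The lifts chosen for different `t` agree by uniqueness of lifts, so the diagonal `t ↦ Γ t t` is
  -- one lift on `[0, T)`; `hlim` supplies its value at `T`.
  have hsub : ∀ t, ∃ γ : ℝ → S, t ∈ Ico 0 T → ContinuousOn γ (Icc 0 t) ∧ γ 0 = x₀ ∧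
      ∀ r ∈ Icc 0 t, p (γ r) = c r := by
    intro t
    by_cases ht : t ∈ Ico 0 T
    · obtain ⟨a, ha, hta⟩ := exists_lt_of_lt_csSup ⟨0, hA0⟩ ht.2
      obtain ⟨-, γ, h1, h2, h3⟩ := ha
      exact ⟨γ, fun _ ↦ ⟨h1.mono (Icc_subset_Icc_right hta.le), h2,
        fun r hr ↦ h3 r ⟨hr.1, hr.2.trans hta.le⟩⟩⟩
    · exact ⟨fun _ ↦ x₀, fun h ↦ absurd h ht⟩
  choose Γ hΓ using hsub
  have hcoh : ∀ t ∈ Ico 0 T, ∀ s ∈ Icc 0 t, Γ s s = Γ t s := by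
    intro t ht s hs
    have hs' : s ∈ Ico 0 T := ⟨hs.1, hs.2.trans_lt ht.2⟩
    have := (T2Space.isSeparatedMap p).eqOn_of_comp_eqOn hp.isLocallyInjective isPreconnected_Icc
      (hΓ s hs').1 ((hΓ t ht).1.mono (Icc_subset_Icc_right hs.2))
      (fun r hr ↦ ((hΓ s hs').2.2 r hr).trans
        ((hΓ t ht).2.2 r ⟨hr.1, hr.2.trans hs.2⟩).symm)
      (a := 0) ⟨le_rfl, hs.1⟩ ((hΓ s hs').2.1.trans (hΓ t ht).2.1.symm)
    exact this ⟨hs.1, le_rfl⟩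
  let γ : ℝ → S := fun t ↦ Γ t t
  have hγc : ContinuousOn γ (Ico 0 T) := by
    intro s hs
    obtain ⟨t, hst, htT⟩ := exists_between hs.2
    have ht : t ∈ Ico 0 T := ⟨hs.1.trans hst.le, htT⟩
    have h1 : ContinuousWithinAt (Γ t) (Icc 0 t) s := (hΓ t ht).1 s ⟨hs.1, hst.le⟩
    have h2 : ContinuousWithinAt γ (Icc 0 t) s :=
      h1.congr (fun r hr ↦ hcoh t ht r hr) (hcoh t ht s ⟨hs.1, hst.le⟩)
    apply h2.mono_of_mem_nhdsWithin
    filter_upwards [self_mem_nhdsWithin, mem_nhdsWithin_of_mem_nhds (Iio_mem_nhds hst)] with r hr hr'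
    exact ⟨hr.1, hr'.le⟩
  have hγlift : ∀ t ∈ Ico 0 T, p (γ t) = c t := fun t ht ↦ (hΓ t ht).2.2 t ⟨ht.1, le_rfl⟩
  obtain ⟨x, hx⟩ := hlim T ⟨hTpos, hT1⟩ γ hγc hγlift
  have hIco : Ico 0 T ∈ 𝓝[<] T := Ico_mem_nhdsLT hTpos
  have hpx : p x = c T := by
    have h1 : Tendsto (fun t ↦ p (γ t)) (𝓝[<] T) (𝓝 (p x)) :=
      (hp.continuous.tendsto x).comp hx
    have h2 : Tendsto (fun t ↦ p (γ t)) (𝓝[<] T) (𝓝 (c T)) :=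
      ((hc.tendsto T).mono_left nhdsWithin_le_nhds).congr'
        (by filter_upwards [hIco] with t ht using (hγlift t ht).symm)
    exact tendsto_nhds_unique h1 h2
  refine ⟨⟨hT0, hT1⟩, Function.update γ T x, ?_, ?_, fun t ht ↦ ?_⟩
  · rw [← Ico_union_right hT0]
    intro t ht
    by_cases h : t = T
    · subst h
      rw [continuousWithinAt_update_same]
      refine hx.mono_left (nhdsWithin_mono _ ?_)
      rintro r ⟨hr | hr, hne⟩
      · exact hr.2
      · exact absurd hr hne
    · have htI : t ∈ Ico 0 T := by
        rcases ht with ht | ht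
        · exact ht
        · exact absurd ht h
      have h1 : ContinuousWithinAt γ (Ico 0 T ∪ {T}) t := by
        apply (hγc t htI).mono_of_mem_nhdsWithin
        filter_upwards [self_mem_nhdsWithin,
          mem_nhdsWithin_of_mem_nhds (Iio_mem_nhds htI.2)] with r hr hr'
        rcases hr with hr | hr
        · exact hr
        · exact absurd hr (ne_of_lt hr')
      exact (continuousWithinAt_update_of_ne h).2 h1
  · rw [Function.update_of_ne hTpos.ne]
    exact (hΓ 0 ⟨le_rfl, hTpos⟩).2.1
  · by_cases h : t = T
    · simp [h, hpx]
    · rw [Function.update_of_ne h]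
      exact hγlift t ⟨ht.1, lt_of_le_of_ne ht.2 h⟩

/-- A local homeomorphism from a connected Hausdorff space into a star-convex set, through which
the segments of that set lift, is a bijection onto that set. -/
theorem IsLocalHomeomorph.injective_and_range_eq_of_starConvex {E : Type*} [NormedAddCommGroup E]
    [NormedSpace ℝ E] [T2Space S] [ConnectedSpace S] {p : S → E} (hp : IsLocalHomeomorph p)
    {U : Set E} (hU : StarConvex ℝ 0 U) (hpU : ∀ x, p x ∈ U)
    (hlift : ∀ x : S, ∀ q : E, segment ℝ (p x) q ⊆ U → ∃ γ : ℝ → S, ContinuousOn γ (Icc 0 1) ∧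
      γ 0 = x ∧ ∀ t ∈ Icc (0 : ℝ) 1, p (γ t) = AffineMap.lineMap (p x) q t) :
    Function.Injective p ∧ range p = U := by
  obtain ⟨s₁⟩ : Nonempty S := inferInstance
  have h0 : ∃ s₀, p s₀ = 0 := by
    obtain ⟨γ, -, -, h⟩ := hlift s₁ 0
      (by rw [segment_symm]; exact hU.segment_subset (hpU s₁))
    exact ⟨γ 1, by simpa using h 1 (by simp)⟩
  obtain ⟨s₀, hs₀⟩ := h0
  have hex : ∀ q : U, ∃ γ : ℝ → S, ContinuousOn γ (Icc 0 1) ∧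
      γ 0 = s₀ ∧ ∀ t ∈ Icc (0 : ℝ) 1, p (γ t) = t • (q : E) := by
    intro q
    obtain ⟨γ, h1, h2, h3⟩ := hlift s₀ q (by rw [hs₀]; exact hU.segment_subset q.2)
    refine ⟨γ, h1, h2, fun t ht ↦ ?_⟩
    simp [h3 t ht, hs₀, AffineMap.lineMap_apply]
  choose Γ hΓc hΓ0 hΓ using hex
  let g : unitInterval × U → S := fun z ↦ Γ z.2 z.1
  -- Homotopy lifting: continuity in `t` for each fixed `q`, together with continuity on the slice
  -- `t = 0`, where `g` is constant, gives joint continuity.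
  have hg : Continuous g := by
    refine hp.continuous_lift (T2Space.isSeparatedMap p)
      ⟨fun z : unitInterval × U ↦ (z.1 : ℝ) • (z.2 : E), by fun_prop⟩ ?_ ?_ ?_
    · ext z
      exact hΓ z.2 z.1 z.1.2
    · simpa [g, hΓ0] using continuous_const
    · intro a
      exact (hΓc a).comp_continuous continuous_subtype_val fun t ↦ t.2
  let σ : U → S := fun q ↦ g (1, q)
  have hσ : Continuous σ := by fun_prop
  have hpσ : ∀ q : U, p (σ q) = q := fun q ↦ by
    simpa [σ, g] using hΓ q 1 (by simp)
  have hrange : range σ = univ := by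
    -- The image of the section is the locus where `σ ∘ p` and the identity agree. It is closed
    -- because `S` is Hausdorff, and open because both maps lift `p` and `p` is locally injective.
    -- It contains `s₀`, since the lift of the constant path is constant.
    have hfix : range σ = {s | σ ⟨p s, hpU s⟩ = s} := by
      ext s
      constructor
      · rintro ⟨q, rfl⟩
        simp [hpσ]
      · intro hs
        exact ⟨_, hs⟩
    rw [hfix]
    refine IsClopen.eq_univ ⟨?_, ?_⟩ ⟨s₀, ?_⟩
    · exact isClosed_eq (hσ.comp (hp.continuous.subtype_mk hpU)) continuous_id
    · exact hp.isLocallyInjective.isOpen_eqLocus (hσ.comp (hp.continuous.subtype_mk hpU))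
        continuous_id (by ext s; simp [hpσ])
    · have h := hΓc ⟨p s₀, hpU s₀⟩
      have := (T2Space.isSeparatedMap p).eqOn_of_comp_eqOn hp.isLocallyInjective
        (isPreconnected_Icc (a := (0 : ℝ)) (b := 1)) h (continuousOn_const (c := s₀))
        (fun t ht ↦ (hΓ ⟨p s₀, hpU s₀⟩ t ht).trans (by simp [hs₀])) (a := 0) (by simp) (hΓ0 _)
      simpa [σ, g] using this (x := 1) (by simp)
  have hleft : ∀ s, σ ⟨p s, hpU s⟩ = s := by
    intro s
    obtain ⟨q, rfl⟩ : s ∈ range σ := by rw [hrange]; trivial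
    simp [hpσ]
  refine ⟨fun s s' h ↦ ?_, Subset.antisymm (range_subset_iff.2 hpU) fun q hq ↦ ⟨σ ⟨q, hq⟩, hpσ _⟩⟩
  rw [← hleft s, ← hleft s']
  simp [h]

end Lifting

/-! ### Local diffeomorphisms -/

section LocalDiffeomorph

variable {E : Type*} [NormedAddCommGroup E] [NormedSpace ℝ E]
  {S : Type*} [TopologicalSpace S] [ChartedSpace E S] {n : WithTop ℕ∞}

theorem IsLocalDiffeomorph.exists_openPartialHomeomorph {p : S → E}
    (hp : IsLocalDiffeomorph 𝓘(ℝ, E) 𝓘(ℝ, E) n p) (x : S) :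
    ∃ e : OpenPartialHomeomorph S E, x ∈ e.source ∧ EqOn p e e.source ∧
      ContMDiffOn 𝓘(ℝ, E) 𝓘(ℝ, E) n e.symm e.target := by
  obtain ⟨Φ, hx, h⟩ := hp x
  exact ⟨Φ.toOpenPartialHomeomorph, hx, h, Φ.contMDiffOn_invFun⟩

/-- The inverse function theorem on a manifold modelled on a finite-dimensional space. -/
theorem isLocalDiffeomorph_of_injective_mfderiv [FiniteDimensional ℝ E]
    [IsManifold 𝓘(ℝ, E) n S] (hn : 1 ≤ n) {p : S → E}
    (hp : ContMDiff 𝓘(ℝ, E) 𝓘(ℝ, E) n p)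
    (hinj : ∀ x, Function.Injective (mfderiv 𝓘(ℝ, E) 𝓘(ℝ, E) p x)) :
    IsLocalDiffeomorph 𝓘(ℝ, E) 𝓘(ℝ, E) n p := by
  have hn0 : n ≠ 0 := (zero_lt_one.trans_le hn).ne'
  have : CompleteSpace E := FiniteDimensional.complete ℝ E
  have : IsManifold 𝓘(ℝ, E) 1 S := IsManifold.of_le hn
  intro x
  let φ := chartAt E x
  let F : E → E := p ∘ φ.symm
  have hFC : ∀ y ∈ φ.target, ContDiffAt ℝ n F y := by
    intro y hy
    rw [← contMDiffAt_iff_contDiffAt]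
    exact (hp _).comp y ((contMDiffOn_chart_symm (I := 𝓘(ℝ, E)) (x := x)).contMDiffAt
      (φ.open_target.mem_nhds hy))
  -- Invertibility is needed on the whole chart image and not only at `φ x`: regularity of the
  -- inverse is checked at every point of its domain.
  have hFD : ∀ y ∈ φ.target, ∃ f' : E ≃L[ℝ] E, HasFDerivAt F (f' : E →L[ℝ] E) y := by
    intro y hy
    have hd : HasFDerivAt F (fderiv ℝ F y) y := ((hFC y hy).differentiableAt hn0).hasFDerivAt
    have hφ := (mdifferentiable_chart (I := 𝓘(ℝ, E)) x)
    have hcomp : mfderiv 𝓘(ℝ, E) 𝓘(ℝ, E) F y =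
        (mfderiv 𝓘(ℝ, E) 𝓘(ℝ, E) p (φ.symm y)).comp (mfderiv 𝓘(ℝ, E) 𝓘(ℝ, E) φ.symm y) :=
      mfderiv_comp y ((hp _).mdifferentiableAt hn0) (hφ.mdifferentiableAt_symm hy)
    have hi : Function.Injective (fderiv ℝ F y) := by
      rw [← mfderiv_eq_fderiv, hcomp]
      exact (hinj _).comp (hφ.symm.mfderiv_injective hy)
    refine ⟨(LinearEquiv.ofInjectiveEndo (fderiv ℝ F y : E →ₗ[ℝ] E) hi).toContinuousLinearEquiv, ?_⟩
    convert hd using 1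
    ext v
    rfl
  have hx : φ x ∈ φ.target := mem_chart_target E x
  obtain ⟨f', hf'⟩ := hFD _ hx
  let e' := (hFC _ hx).toOpenPartialHomeomorph F hf' hn0
  let e := φ.trans e'
  have hee : EqOn p e e.source := by
    intro y hy
    have hy' : y ∈ φ.source := by
      simp only [e, OpenPartialHomeomorph.trans_source] at hy
      exact hy.1
    change p y = p (φ.symm (φ y))
    rw [φ.left_inv hy']
  refine ⟨⟨e.toPartialEquiv, e.open_source, e.open_target, ?_, ?_⟩, ?_, hee⟩
  · exact hp.contMDiffOn.congr fun y hy ↦ (hee hy).symm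
  · intro y hy
    have hy' : y ∈ e'.target ∧ e'.symm y ∈ φ.target := by
      have : y ∈ e.target := hy
      simpa [e, OpenPartialHomeomorph.trans_target] using this
    apply ContMDiffAt.contMDiffWithinAt
    obtain ⟨g', hg'⟩ := hFD _ hy'.2
    have h1 : ContMDiffAt 𝓘(ℝ, E) 𝓘(ℝ, E) n e'.symm y :=
      contMDiffAt_iff_contDiffAt.2 (e'.contDiffAt_symm hy'.1 hg' (hFC _ hy'.2))
    have h2 : ContMDiffAt 𝓘(ℝ, E) 𝓘(ℝ, E) n φ.symm (e'.symm y) :=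
      contMDiffOn_chart_symm.contMDiffAt (φ.open_target.mem_nhds hy'.2)
    exact h2.comp y h1
  · change x ∈ (φ.trans e').source
    rw [OpenPartialHomeomorph.trans_source]
    exact ⟨mem_chart_source E x,
      ContDiffAt.mem_toOpenPartialHomeomorph_source (hFC _ hx) hf' hn0⟩

/-- A continuous lift of a `C^m` path through a local diffeomorphism is `C^m`. -/
theorem IsLocalDiffeomorph.contMDiffOn_lift {p : S → E}
    (hp : IsLocalDiffeomorph 𝓘(ℝ, E) 𝓘(ℝ, E) n p) {m : WithTop ℕ∞} (hm : m ≤ n)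
    {s : Set ℝ} {γ : ℝ → S} (hγ : ContinuousOn γ s) (hpγ : ContDiffOn ℝ m (p ∘ γ) s) :
    ContMDiffOn 𝓘(ℝ, ℝ) 𝓘(ℝ, E) m γ s := by
  intro t ht
  obtain ⟨e, hx, hpe, hsymm⟩ := hp.exists_openPartialHomeomorph (γ t)
  have hnear : ∀ᶠ r in 𝓝[s] t, γ r ∈ e.source :=
    (hγ t ht).eventually_mem (e.open_source.mem_nhds hx)
  have heq : γ =ᶠ[𝓝[s] t] e.symm ∘ (p ∘ γ) := by
    filter_upwards [hnear] with r hr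
    simp [hpe hr, e.left_inv hr]
  refine ContMDiffWithinAt.congr_of_eventuallyEq ?_ heq (by simp [hpe hx, e.left_inv hx])
  have h1 : ContMDiffAt 𝓘(ℝ, E) 𝓘(ℝ, E) m e.symm ((p ∘ γ) t) := by
    refine (hsymm.contMDiffAt (e.open_target.mem_nhds ?_)).of_le hm
    simpa [hpe hx] using e.map_source hx
  exact h1.comp_contMDiffWithinAt t (hpγ t ht).contMDiffWithinAt

/-- The inclusion of an open set of the model space is a local diffeomorphism. -/
theorem TopologicalSpace.Opens.isLocalDiffeomorph_subtype_val (U : TopologicalSpace.Opens E) :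
    IsLocalDiffeomorph 𝓘(ℝ, E) 𝓘(ℝ, E) n (Subtype.val : U → E) := by
  intro x
  let φ := chartAt E x
  refine ⟨⟨φ.toPartialEquiv, φ.open_source, φ.open_target, contMDiffOn_chart,
    contMDiffOn_chart_symm⟩, mem_chart_source E x, fun y _ ↦ ?_⟩
  rfl

end LocalDiffeomorph

/-! ### Riemannian distances compared through a local diffeomorphism -/

section Distance

variable {E : Type*} [NormedAddCommGroup E] [NormedSpace ℝ E]
  {S : Type*} [TopologicalSpace S] [ChartedSpace E S] {n : WithTop ℕ∞} {p : S → E}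

theorem deriv_comp_eq_mfderiv_apply {γ : ℝ → S} {t : ℝ}
    (hp : MDifferentiableAt 𝓘(ℝ, E) 𝓘(ℝ, E) p (γ t))
    (hγ : MDifferentiableAt 𝓘(ℝ, ℝ) 𝓘(ℝ, E) γ t) :
    deriv (p ∘ γ) t =
      mfderiv 𝓘(ℝ, E) 𝓘(ℝ, E) p (γ t) (mfderiv 𝓘(ℝ, ℝ) 𝓘(ℝ, E) γ t (1 : ℝ)) := by
  rw [← fderiv_apply_one_eq_deriv, ← mfderiv_eq_fderiv, mfderiv_comp t hp hγ]
  rfl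

variable [∀ x : S, ENorm (TangentSpace 𝓘(ℝ, E) x)]

theorem pathELength_eq_lintegral_of_enorm_eq (hp : IsLocalDiffeomorph 𝓘(ℝ, E) 𝓘(ℝ, E) n p)
    (hn : 1 ≤ n) {w : E → ℝ}
    (hN : ∀ (x : S) (v : TangentSpace 𝓘(ℝ, E) x), ‖v‖ₑ =
      ENNReal.ofReal (w (p x) * norm (E := E) (mfderiv 𝓘(ℝ, E) 𝓘(ℝ, E) p x v)))
    {a b : ℝ} {γ : ℝ → S} (hγ : ContMDiffOn 𝓘(ℝ, ℝ) 𝓘(ℝ, E) 1 γ (Icc a b)) :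
    pathELength 𝓘(ℝ, E) γ a b =
      ∫⁻ t in Ioo a b, ENNReal.ofReal (w (p (γ t)) * ‖deriv (p ∘ γ) t‖) := by
  rw [pathELength_eq_lintegral_mfderiv_Ioo]
  refine MeasureTheory.setLIntegral_congr_fun measurableSet_Ioo fun t ht ↦ ?_
  have hd : MDifferentiableAt 𝓘(ℝ, ℝ) 𝓘(ℝ, E) γ t :=
    (hγ.contMDiffAt (Icc_mem_nhds ht.1 ht.2)).mdifferentiableAt one_ne_zero
  rw [deriv_comp_eq_mfderiv_apply ((hp _).mdifferentiableAt (zero_lt_one.trans_le hn).ne') hd]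
  exact hN _ _

variable [∀ x : S, ENormSMulClass ℝ (TangentSpace 𝓘(ℝ, E) x)]

/-- The lift is only assumed continuous; its regularity is inherited from `p ∘ γ`. An upper bound on
the norm is enough here, which is what a spacelike surface offers relative to the base. -/
theorem riemannianEDist_le_lintegral_of_lift (hp : IsLocalDiffeomorph 𝓘(ℝ, E) 𝓘(ℝ, E) n p)
    (hn : 1 ≤ n) {w : E → ℝ}
    (hN : ∀ (x : S) (v : TangentSpace 𝓘(ℝ, E) x), ‖v‖ₑ ≤
      ENNReal.ofReal (w (p x) * norm (E := E) (mfderiv 𝓘(ℝ, E) 𝓘(ℝ, E) p x v)))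
    {a b : ℝ} (hab : a ≤ b) {γ : ℝ → S} (hγ : ContinuousOn γ (Icc a b))
    (hpγ : ContDiffOn ℝ 1 (p ∘ γ) (Icc a b)) :
    riemannianEDist 𝓘(ℝ, E) (γ a) (γ b) ≤
      ∫⁻ t in Ioo a b, ENNReal.ofReal (w (p (γ t)) * ‖deriv (p ∘ γ) t‖) := by
  have hC := hp.contMDiffOn_lift hn hγ hpγ
  refine (riemannianEDist_le_pathELength hC rfl rfl hab).trans ?_
  rw [pathELength_eq_lintegral_mfderiv_Ioo]
  refine MeasureTheory.setLIntegral_mono' measurableSet_Ioo fun t ht ↦ ?_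
  have hd : MDifferentiableAt 𝓘(ℝ, ℝ) 𝓘(ℝ, E) γ t :=
    (hC.contMDiffAt (Icc_mem_nhds ht.1 ht.2)).mdifferentiableAt one_ne_zero
  rw [deriv_comp_eq_mfderiv_apply ((hp _).mdifferentiableAt (zero_lt_one.trans_le hn).ne') hd]
  exact hN _ _

theorem riemannianEDist_le_of_lift_lineMap (hp : IsLocalDiffeomorph 𝓘(ℝ, E) 𝓘(ℝ, E) n p)
    (hn : 1 ≤ n) {w : E → ℝ}
    (hN : ∀ (x : S) (v : TangentSpace 𝓘(ℝ, E) x), ‖v‖ₑ ≤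
      ENNReal.ofReal (w (p x) * norm (E := E) (mfderiv 𝓘(ℝ, E) 𝓘(ℝ, E) p x v)))
    {a b : ℝ} (hab : a ≤ b) {γ : ℝ → S} (hγ : ContinuousOn γ (Icc a b)) {q q' : E}
    (hlift : ∀ t ∈ Icc a b, p (γ t) = AffineMap.lineMap q q' t) {L : ℝ}
    (hL : ∀ t ∈ Icc a b, w (AffineMap.lineMap q q' t) ≤ L) :
    riemannianEDist 𝓘(ℝ, E) (γ a) (γ b) ≤ ENNReal.ofReal (L * ‖q' - q‖ * (b - a)) := by
  have hC : ContDiff ℝ 1 (fun t : ℝ ↦ AffineMap.lineMap q q' t : ℝ → E) :=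
    (ContinuousAffineMap.lineMap (R := ℝ) q q').contDiff
  refine (riemannianEDist_le_lintegral_of_lift hp hn hN hab hγ
    (hC.contDiffOn.congr hlift)).trans ?_
  calc ∫⁻ t in Ioo a b, ENNReal.ofReal (w (p (γ t)) * ‖deriv (p ∘ γ) t‖)
      ≤ ∫⁻ t in Ioo a b, ENNReal.ofReal (L * ‖q' - q‖) := by
        refine MeasureTheory.setLIntegral_mono' measurableSet_Ioo fun t ht ↦ ?_
        have ht' : t ∈ Icc a b := ⟨ht.1.le, ht.2.le⟩
        have heq : p ∘ γ =ᶠ[𝓝 t] fun t ↦ AffineMap.lineMap q q' t := by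
          filter_upwards [Icc_mem_nhds ht.1 ht.2] with r hr using hlift r hr
        rw [heq.deriv_eq, hlift t ht', AffineMap.hasDerivAt_lineMap.deriv]
        exact ENNReal.ofReal_le_ofReal (mul_le_mul_of_nonneg_right (hL t ht') (norm_nonneg _))
    _ = ENNReal.ofReal (L * ‖q' - q‖ * (b - a)) := by
        rw [MeasureTheory.setLIntegral_const, Real.volume_Ioo,
          ENNReal.ofReal_mul' (sub_nonneg.2 hab)]

/-- If the norm on tangent vectors is locally bounded below through a local diffeomorphism, then
small Riemannian balls are small neighborhoods. -/
theorem exists_riemannianEDist_lt_subset [ProperSpace E] [T2Space S]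
    (hp : IsLocalDiffeomorph 𝓘(ℝ, E) 𝓘(ℝ, E) n p) (hn : 1 ≤ n) {x : S} {c : ℝ} (hc : 0 < c)
    (hN : ∀ᶠ y in 𝓝 x, ∀ v : TangentSpace 𝓘(ℝ, E) y,
      ENNReal.ofReal (c * norm (E := E) (mfderiv 𝓘(ℝ, E) 𝓘(ℝ, E) p y v)) ≤ ‖v‖ₑ)
    {u : Set S} (hu : u ∈ 𝓝 x) :
    ∃ r : ℝ≥0∞, 0 < r ∧ ∀ y, riemannianEDist 𝓘(ℝ, E) x y < r → y ∈ u := by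
  obtain ⟨e, hx, hpe, hsymm⟩ := hp.exists_openPartialHomeomorph x
  have hpx : p x = e x := hpe hx
  have hxt : p x ∈ e.target := hpx ▸ e.map_source hx
  have hsx : e.symm (p x) = x := by rw [hpx, e.left_inv hx]
  have hcont : Tendsto e.symm (𝓝 (p x)) (𝓝 x) := by
    simpa [hpx, e.left_inv hx] using e.continuousAt_symm hxt |>.tendsto
  have hgood : ∀ᶠ q in 𝓝 (p x), q ∈ e.target ∧ e.symm q ∈ u ∧
      ∀ v : TangentSpace 𝓘(ℝ, E) (e.symm q), ENNReal.ofReal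
        (c * norm (E := E) (mfderiv 𝓘(ℝ, E) 𝓘(ℝ, E) p (e.symm q) v)) ≤ ‖v‖ₑ :=
    (e.open_target.mem_nhds hxt |> fun h ↦ (eventually_mem_set.2 h)).and
      ((hcont.eventually hu).and (hcont.eventually hN))
  obtain ⟨r, hr, hball⟩ := Metric.nhds_basis_closedBall.mem_iff.1 hgood
  -- A compact set in a Hausdorff space is closed, so a path leaving the open ball upstairs still
  -- has its first exit point inside the chart.
  have hK : IsClosed (e.symm '' Metric.closedBall (p x) r) :=
    ((isCompact_closedBall (p x) r).image_of_continuousOn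
      (e.continuousOn_symm.mono fun q hq ↦ (hball hq).1)).isClosed
  have hO : IsOpen (e.symm '' Metric.ball (p x) r) :=
    e.symm.isOpen_image_of_subset_source Metric.isOpen_ball
      fun q hq ↦ (hball (Metric.ball_subset_closedBall hq)).1
  set O := e.symm '' Metric.ball (p x) r
  have hOK : O ⊆ e.symm '' Metric.closedBall (p x) r := image_mono Metric.ball_subset_closedBall
  have hps : ∀ q ∈ Metric.closedBall (p x) r, p (e.symm q) = q := fun q hq ↦ by
    rw [hpe (e.map_target (hball hq).1), e.right_inv (hball hq).1]
  -- A path that leaves `O` has projected displacement at least `r` by its first exit time `t₀`, and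
  -- up to then its length is at least `c` times that displacement.
  refine ⟨ENNReal.ofReal (c * r), by positivity, fun y hy ↦ ?_⟩
  obtain ⟨γ, hγx, hγy, hγC, hlen, -⟩ :=
    exists_lt_locally_constant_of_riemannianEDist_lt hy zero_lt_one
  suffices hall : ∀ t ∈ Icc (0 : ℝ) 1, γ t ∈ O by
    obtain ⟨q, hq, hqy⟩ := hall 1 (by simp)
    rw [← hγy, ← hqy]
    exact (hball (Metric.ball_subset_closedBall hq)).2.1
  by_contra! hne
  have hTcpt : IsCompact (Icc (0 : ℝ) 1 ∩ γ ⁻¹' Oᶜ) :=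
    isCompact_Icc.inter_right (hO.isClosed_compl.preimage hγC.continuous)
  obtain ⟨t₀, ⟨⟨ht₀, ht₁⟩, ht₀O⟩, hleast⟩ := hTcpt.exists_isLeast hne
  have hbefore : ∀ t ∈ Ico 0 t₀, γ t ∈ O := by
    intro t ht
    by_contra h
    exact absurd (hleast ⟨⟨ht.1, ht.2.le.trans ht₁⟩, h⟩) (not_le.2 ht.2)
  have hxO : x ∈ O := ⟨p x, Metric.mem_ball_self hr, hsx⟩
  have ht₀pos : 0 < t₀ := by
    rcases ht₀.eq_or_lt with h | h
    · rw [← h] at ht₀O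
      exact absurd (hγx ▸ hxO) ht₀O
    · exact h
  have hlimK : γ t₀ ∈ e.symm '' Metric.closedBall (p x) r := by
    have htend : Tendsto γ (𝓝[<] t₀) (𝓝 (γ t₀)) :=
      (hγC.continuous.tendsto t₀).mono_left nhdsWithin_le_nhds
    refine hK.mem_of_tendsto htend ?_
    filter_upwards [Ico_mem_nhdsLT ht₀pos] with t ht using hOK (hbefore t ht)
  obtain ⟨q, hq, hqt⟩ := hlimK
  have hq' : r ≤ ‖p (γ t₀) - p (γ 0)‖ := by
    rw [hγx, ← hqt, hps q hq, ← dist_eq_norm]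
    by_contra! h
    exact ht₀O ⟨q, h, hqt⟩
  have hn0 : n ≠ 0 := (zero_lt_one.trans_le hn).ne'
  have hpC : ContDiff ℝ 1 (p ∘ γ) :=
    contMDiff_iff_contDiff.1 ((hp.contMDiff.of_le hn).comp hγC)
  have hfin : ENNReal.ofReal (c * r) ≤ pathELength 𝓘(ℝ, E) γ 0 1 := calc
    ENNReal.ofReal (c * r) ≤ ENNReal.ofReal c * ‖(p ∘ γ) t₀ - (p ∘ γ) 0‖ₑ := by
      rw [ENNReal.ofReal_mul hc.le, ← ofReal_norm]
      gcongr
      exact hq'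
    _ ≤ ENNReal.ofReal c * ∫⁻ t in Icc 0 t₀, ‖deriv (p ∘ γ) t‖ₑ := by
      gcongr
      exact enorm_sub_le_lintegral_deriv_of_contDiffOn_Icc hpC.contDiffOn ht₀
    _ = ∫⁻ t in Ioo 0 t₀, ENNReal.ofReal c * ‖deriv (p ∘ γ) t‖ₑ := by
      rw [MeasureTheory.lintegral_const_mul' _ _ ENNReal.ofReal_ne_top,
        MeasureTheory.restrict_Ioo_eq_restrict_Icc]
    _ ≤ pathELength 𝓘(ℝ, E) γ 0 t₀ := by
      rw [pathELength_eq_lintegral_mfderiv_Ioo]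
      refine MeasureTheory.setLIntegral_mono' measurableSet_Ioo fun t ht ↦ ?_
      rw [← ofReal_norm (deriv (p ∘ γ) t), ← ENNReal.ofReal_mul hc.le,
        deriv_comp_eq_mfderiv_apply ((hp _).mdifferentiableAt hn0)
          (hγC.mdifferentiable one_ne_zero t)]
      obtain ⟨q, hq, hqt⟩ := hbefore t ⟨ht.1.le, ht.2⟩
      have := (hball (Metric.ball_subset_closedBall hq)).2.2
      rw [hqt] at this
      exact this _
    _ ≤ pathELength 𝓘(ℝ, E) γ 0 1 := pathELength_mono le_rfl ht₁
  exact absurd hlen (not_lt.2 hfin)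

end Distance

/-! ### Induced metrics -/

section Induced

variable {F : Type*} [NormedAddCommGroup F] [NormedSpace ℝ F]
  {S : Type*} [TopologicalSpace S] [ChartedSpace Plane S]

/-- The length of tangent vectors for the induced metric `f^* g`. -/
@[reducible]
def inducedENorm (g : F → F → F → ℝ) (f : S → F) (z : S) : ENorm (TangentSpace 𝓘(ℝ, Plane) z) :=
  ⟨fun v ↦ ENNReal.ofReal (Real.sqrt (inducedMetric g f z v v))⟩

/-- Homogeneity is the only property of the length function that the Riemannian distance lemmas used
below require. Quadratic scaling of `g` on the diagonal provides it, with no positivity or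
bilinearity. -/
theorem inducedENorm_smulClass {g : F → F → F → ℝ}
    (hg : ∀ p (t : ℝ) v, g p (t • v) (t • v) = t ^ 2 * g p v v) (f : S → F) (z : S) :
    letI := inducedENorm g f z
    ENormSMulClass ℝ (TangentSpace 𝓘(ℝ, Plane) z) := by
  let := inducedENorm g f z
  refine ⟨fun t v ↦ ?_⟩
  change ENNReal.ofReal (Real.sqrt (inducedMetric g f z (t • v) (t • v))) =
    ‖t‖ₑ * ENNReal.ofReal (Real.sqrt (inducedMetric g f z v v))
  have h : inducedMetric g f z (t • v) (t • v) = t ^ 2 * inducedMetric g f z v v := by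
    unfold inducedMetric
    rw [map_smul]
    exact hg _ _ _
  rw [h, Real.sqrt_mul (sq_nonneg t), Real.sqrt_sq_eq_abs, ENNReal.ofReal_mul (abs_nonneg t),
    ← ofReal_norm t, Real.norm_eq_abs]

end Induced

/-! ### The base metric and the spacetime metric -/

section Metric

variable {δ τ : Plane → ℝ}

theorem baseMetric_self (q v : Plane) : baseMetric δ q v v = ‖v‖ ^ 2 / δ q ^ 2 := by
  rw [EuclideanSpace.norm_sq_eq]
  simp [baseMetric, Fin.sum_univ_two, sq]

theorem baseMetric_smul (q : Plane) (t : ℝ) (v : Plane) :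
    baseMetric δ q (t • v) (t • v) = t ^ 2 * baseMetric δ q v v := by
  simp only [baseMetric, PiLp.smul_apply, smul_eq_mul]
  ring

theorem sqrt_baseMetric_self {q : Plane} (hq : 0 < δ q) (v : Plane) :
    Real.sqrt (baseMetric δ q v v) = (δ q)⁻¹ * ‖v‖ := by
  rw [baseMetric_self, ← div_pow, Real.sqrt_sq (by positivity), div_eq_inv_mul]

theorem spacetimeMetric_smul (q : Plane × ℝ) (t : ℝ) (v : Plane × ℝ) :
    spacetimeMetric δ τ q (t • v) (t • v) = t ^ 2 * spacetimeMetric δ τ q v v := by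
  simp only [spacetimeMetric, verticalForm, Prod.smul_fst, Prod.smul_snd, baseMetric_smul,
    PiLp.smul_apply, smul_eq_mul]
  ring

theorem spacetimeMetric_self_le (q v : Plane × ℝ) :
    spacetimeMetric δ τ q v v ≤ baseMetric δ q.1 v.1 v.1 :=
  sub_le_self _ (mul_self_nonneg _)

/-- Star-convexity keeps `t • q` in `U` for `t ∈ [0, 1]`, so the integrand is jointly continuous and
the parametric integral is continuous. -/
theorem continuousOn_calabiPotential {U : Set Plane} (hU : StarConvex ℝ 0 U)
    (hδ : ContinuousOn δ U) (hδ_pos : ∀ q ∈ U, 0 < δ q) (hτ : ContinuousOn τ U) :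
    ContinuousOn (calabiPotential δ τ) U := by
  rw [continuousOn_iff_continuous_domRestrict]
  -- Clamping `t` to `[0, 1]` makes the integrand continuous for all real `t` without changing the
  -- integral.
  let ρ : ℝ → ℝ := fun t ↦ projIcc (0 : ℝ) 1 zero_le_one t
  have hρ : Continuous ρ := continuous_subtype_val.comp continuous_projIcc
  have hmem : ∀ z : U × ℝ, ρ z.2 • (z.1 : Plane) ∈ U := fun z ↦
    hU.smul_mem z.1.2 (projIcc (0 : ℝ) 1 zero_le_one z.2).2.1
      (projIcc (0 : ℝ) 1 zero_le_one z.2).2.2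
  have hc : Continuous fun z : U × ℝ ↦ ρ z.2 • (z.1 : Plane) := by fun_prop
  have hF : Continuous (Function.uncurry fun (q : U) (t : ℝ) ↦
      ρ t * (τ (ρ t • (q : Plane)) / δ (ρ t • (q : Plane)) ^ 2)) := by
    refine (hρ.comp continuous_snd).mul ((hτ.comp_continuous hc hmem).div
      ((hδ.comp_continuous hc hmem).pow 2) fun z ↦ ?_)
    exact pow_ne_zero _ (hδ_pos _ (hmem z)).ne'
  have := (intervalIntegral.continuous_parametric_intervalIntegral_of_continuous'
    (μ := MeasureTheory.volume) hF 0 1).const_mul 2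
  refine this.congr fun q ↦ ?_
  simp only [domRestrict_apply, calabiPotential]
  congr 1
  refine intervalIntegral.integral_congr fun t ht ↦ ?_
  rw [uIcc_of_le zero_le_one] at ht
  have : ρ t = t := by simp [ρ, projIcc_of_mem zero_le_one ht]
  simp only [this]

end Metric

/-! ### Spacelike surfaces -/

section Spacelike

variable {S : Type*} [TopologicalSpace S] [ChartedSpace Plane S]

theorem mfderiv_fst_apply {f : S → Plane × ℝ} {x : S}
    (hf : MDifferentiableAt 𝓘(ℝ, Plane) 𝓘(ℝ, Plane × ℝ) f x) (v : TangentSpace 𝓘(ℝ, Plane) x) :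
    mfderiv 𝓘(ℝ, Plane) 𝓘(ℝ, Plane) (fun y ↦ (f y).1) x v =
      (show Plane × ℝ from mfderiv 𝓘(ℝ, Plane) 𝓘(ℝ, Plane × ℝ) f x v).1 := by
  have h := mfderiv_comp x (ContinuousLinearMap.fst ℝ Plane ℝ).mdifferentiableAt hf
  rw [ContinuousLinearMap.mfderiv_eq] at h
  exact DFunLike.congr_fun h v

theorem mfderiv_snd_apply {f : S → Plane × ℝ} {x : S}
    (hf : MDifferentiableAt 𝓘(ℝ, Plane) 𝓘(ℝ, Plane × ℝ) f x) (v : TangentSpace 𝓘(ℝ, Plane) x) :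
    mfderiv 𝓘(ℝ, Plane) 𝓘(ℝ, ℝ) (fun y ↦ (f y).2) x v =
      (show Plane × ℝ from mfderiv 𝓘(ℝ, Plane) 𝓘(ℝ, Plane × ℝ) f x v).2 := by
  have h := mfderiv_comp x (ContinuousLinearMap.snd ℝ Plane ℝ).mdifferentiableAt hf
  rw [ContinuousLinearMap.mfderiv_eq] at h
  exact DFunLike.congr_fun h v

variable {δ τ : Plane → ℝ} {f : S → Plane × ℝ} {n : WithTop ℕ∞}

theorem inducedMetric_spacetime_le
    (hf : MDifferentiable 𝓘(ℝ, Plane) 𝓘(ℝ, Plane × ℝ) f) (x : S)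
    (v : TangentSpace 𝓘(ℝ, Plane) x) :
    inducedMetric (spacetimeMetric δ τ) f x v v ≤
      inducedMetric (baseMetric δ) (fun y ↦ (f y).1) x v v := by
  unfold inducedMetric
  rw [mfderiv_fst_apply (hf x)]
  exact spacetimeMetric_self_le _ _

/-- A vector in the kernel of the differential has base norm zero, and the base norm bounds the
spacetime norm from above; positive definiteness forces the vector to vanish. -/
theorem isLocalDiffeomorph_fst [IsManifold 𝓘(ℝ, Plane) n S] (hn : 1 ≤ n)
    (hf : ContMDiff 𝓘(ℝ, Plane) 𝓘(ℝ, Plane × ℝ) n f)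
    (hs : IsRiemannianInduced (spacetimeMetric δ τ) f) :
    IsLocalDiffeomorph 𝓘(ℝ, Plane) 𝓘(ℝ, Plane) n (fun y ↦ (f y).1) := by
  have hn0 : n ≠ 0 := (zero_lt_one.trans_le hn).ne'
  refine isLocalDiffeomorph_of_injective_mfderiv hn
    ((ContinuousLinearMap.fst ℝ Plane ℝ).contMDiff.comp hf) fun x ↦ ?_
  refine (injective_iff_map_eq_zero _).2 fun v hv ↦ ?_
  by_contra hne
  have h1 := (hs x v hne).trans_le (inducedMetric_spacetime_le (hf.mdifferentiable hn0) x v)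
  have h2 : inducedMetric (baseMetric δ) (fun y ↦ (f y).1) x v v = 0 := by
    unfold inducedMetric
    rw [hv]
    exact (baseMetric_self (δ := δ) (f x).1 0).trans (by simp)
  exact h1.ne' h2

/-- Over the chart `e` the surface is the graph of `q ↦ (f (e.symm q)).2`. This makes the vertical
component of `df` a function of the horizontal one. -/
theorem mfderiv_snd_eq_fderiv_graph (hn : 1 ≤ n)
    (hf : ContMDiff 𝓘(ℝ, Plane) 𝓘(ℝ, Plane × ℝ) n f)
    (hp : IsLocalDiffeomorph 𝓘(ℝ, Plane) 𝓘(ℝ, Plane) n (fun y ↦ (f y).1))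
    {e : OpenPartialHomeomorph S Plane} (hpe : EqOn (fun y ↦ (f y).1) e e.source)
    (he : ContMDiffOn 𝓘(ℝ, Plane) 𝓘(ℝ, Plane) n e.symm e.target) {y : S} (hy : y ∈ e.source)
    (v : TangentSpace 𝓘(ℝ, Plane) y) :
    (show Plane × ℝ from mfderiv 𝓘(ℝ, Plane) 𝓘(ℝ, Plane × ℝ) f y v).2 =
      fderiv ℝ (fun q ↦ (f (e.symm q)).2) (f y).1
        (mfderiv 𝓘(ℝ, Plane) 𝓘(ℝ, Plane) (fun y ↦ (f y).1) y v) := by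
  have hn0 : n ≠ 0 := (zero_lt_one.trans_le hn).ne'
  rw [← mfderiv_snd_apply (hf.mdifferentiable hn0 y)]
  let h : Plane → ℝ := fun q ↦ (f (e.symm q)).2
  have hye : (f y).1 = e y := hpe hy
  have hd : MDifferentiableAt 𝓘(ℝ, Plane) 𝓘(ℝ, ℝ) h (f y).1 := by
    have h1 : ContMDiffAt 𝓘(ℝ, Plane) 𝓘(ℝ, Plane) n e.symm (f y).1 :=
      he.contMDiffAt (e.open_target.mem_nhds (hye ▸ e.map_source hy))
    have h2 : ContMDiffAt 𝓘(ℝ, Plane) 𝓘(ℝ, ℝ) n h (f y).1 :=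
      ((ContinuousLinearMap.snd ℝ Plane ℝ).contMDiff _).comp _ ((hf _).comp _ h1)
    exact h2.mdifferentiableAt hn0
  have heq : (fun y ↦ (f y).2) =ᶠ[𝓝 y] h ∘ (fun y ↦ (f y).1) := by
    filter_upwards [e.open_source.mem_nhds hy] with z hz
    have hze : (f z).1 = e z := hpe hz
    simp [h, hze, e.left_inv hz]
  rw [heq.mfderiv_eq, mfderiv_comp y hd ((hp y).mdifferentiableAt hn0), mfderiv_eq_fderiv]
  rfl

theorem contDiffOn_graph
    (hf : ContMDiff 𝓘(ℝ, Plane) 𝓘(ℝ, Plane × ℝ) n f)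
    {e : OpenPartialHomeomorph S Plane}
    (he : ContMDiffOn 𝓘(ℝ, Plane) 𝓘(ℝ, Plane) n e.symm e.target) :
    ContDiffOn ℝ n (fun q ↦ (f (e.symm q)).2) e.target :=
  contMDiffOn_iff_contDiffOn.1
    (((ContinuousLinearMap.snd ℝ Plane ℝ).contMDiff.comp hf).comp_contMDiffOn he)

/-- Near each point, the induced metric of a spacelike surface is bounded below by a multiple of
the Euclidean metric of the plane. -/
theorem exists_lower_bound_inducedMetric {U : Set Plane} (hU : StarConvex ℝ 0 U)
    (hδ : ContinuousOn δ U) (hδ_pos : ∀ q ∈ U, 0 < δ q) (hτ : ContinuousOn τ U)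
    (hn : 1 ≤ n) (hf : ContMDiff 𝓘(ℝ, Plane) 𝓘(ℝ, Plane × ℝ) n f)
    (hfU : ∀ x, (f x).1 ∈ U)
    (hp : IsLocalDiffeomorph 𝓘(ℝ, Plane) 𝓘(ℝ, Plane) n (fun y ↦ (f y).1))
    (hs : IsRiemannianInduced (spacetimeMetric δ τ) f) (x : S) :
    ∃ c > 0, ∀ᶠ y in 𝓝 x, ∀ v : TangentSpace 𝓘(ℝ, Plane) y,
      c * norm (E := Plane) (mfderiv 𝓘(ℝ, Plane) 𝓘(ℝ, Plane) (fun y ↦ (f y).1) y v) ≤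
        Real.sqrt (inducedMetric (spacetimeMetric δ τ) f y v v) := by
  have hn0 : n ≠ 0 := (zero_lt_one.trans_le hn).ne'
  obtain ⟨e, hx, hpe, he⟩ := hp.exists_openPartialHomeomorph x
  have hxe : (f x).1 = e x := hpe hx
  let h : Plane → ℝ := fun q ↦ (f (e.symm q)).2
  have hh : ContDiffOn ℝ n h e.target := contDiffOn_graph hf he
  -- The induced quadratic form read in the local graph, as a function on a product of planes, where
  -- compactness can be applied.
  let G : Plane × Plane → ℝ := fun z ↦
    spacetimeMetric δ τ (z.1, h z.1) (z.2, fderiv ℝ h z.1 z.2) (z.2, fderiv ℝ h z.1 z.2)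
  have hGeq : ∀ y ∈ e.source, ∀ v : TangentSpace 𝓘(ℝ, Plane) y,
      G ((f y).1, mfderiv 𝓘(ℝ, Plane) 𝓘(ℝ, Plane) (fun y ↦ (f y).1) y v) =
        inducedMetric (spacetimeMetric δ τ) f y v v := by
    intro y hy v
    have hye : (f y).1 = e y := hpe hy
    have h1 := mfderiv_fst_apply (hf.mdifferentiable hn0 y) v
    have h2 := mfderiv_snd_eq_fderiv_graph hn hf hp hpe he hy v
    have h3 : h (f y).1 = (f y).2 := by simp [h, hye, e.left_inv hy]
    simp only [G, inducedMetric]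
    erw [← h2, h3, h1]
    rfl
  have hUe : ∀ q ∈ e.target, q ∈ U := by
    intro q hq
    have := hfU (e.symm q)
    rwa [show (f (e.symm q)).1 = q from (hpe (e.map_target hq)).trans (e.right_inv hq)] at this
  have hGpos : ∀ q ∈ e.target, ∀ v : Plane, v ≠ 0 → 0 < G (q, v) := by
    intro q hq v hv
    have hy : e.symm q ∈ e.source := e.map_target hq
    have hqy : (f (e.symm q)).1 = q := (hpe hy).trans (e.right_inv hq)
    obtain ⟨v', hv'⟩ := ((hp (e.symm q)).mfderivToContinuousLinearEquiv hn0).surjective v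
    have hv'' : mfderiv 𝓘(ℝ, Plane) 𝓘(ℝ, Plane) (fun y ↦ (f y).1) (e.symm q) v' = v := hv'
    have := hGeq _ hy v'
    rw [hv'', hqy] at this
    rw [this]
    refine hs _ _ fun h0 ↦ hv ?_
    rw [← hv'', h0]
    exact map_zero _
  have hGc : ContinuousOn G (e.target ×ˢ univ) := by
    have hfst : ContinuousOn (fun z : Plane × Plane ↦ z.1) (e.target ×ˢ univ) :=
      continuous_fst.continuousOn
    have hm : MapsTo (fun z : Plane × Plane ↦ z.1) (e.target ×ˢ univ) U := fun z hz ↦ hUe _ hz.1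
    have hm' : MapsTo (fun z : Plane × Plane ↦ z.1) (e.target ×ˢ univ) e.target := fun z hz ↦ hz.1
    have hδ' := hδ.comp hfst hm
    have hC' := (continuousOn_calabiPotential hU hδ hδ_pos hτ).comp hfst hm
    have hD' := ((hh.continuousOn_fderiv_of_isOpen e.open_target hn).comp hfst hm').clm_apply
      (continuous_snd.continuousOn (s := e.target ×ˢ univ))
    have hne : ∀ z ∈ e.target ×ˢ (univ : Set Plane), δ z.1 ^ 2 ≠ 0 := fun z hz ↦
      pow_ne_zero _ (hδ_pos _ (hm hz)).ne'
    simp only [Function.comp_def] at hδ' hC' hD'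
    have hV : ContinuousOn (fun z : Plane × Plane ↦ verticalForm δ τ (z.1, h z.1)
        (z.2, fderiv ℝ h z.1 z.2)) (e.target ×ˢ univ) :=
      hD'.sub (hC'.mul (by fun_prop))
    exact ((by fun_prop : ContinuousOn (fun z : Plane × Plane ↦ z.2 0 * z.2 0 + z.2 1 * z.2 1)
      (e.target ×ˢ univ)).div (hδ'.pow 2) hne).sub (hV.mul hV)
  obtain ⟨r, hr, hball⟩ := Metric.nhds_basis_closedBall.mem_iff.1
    (e.open_target.mem_nhds (hxe ▸ e.map_source hx))
  -- A positive lower bound over a compact ball of base points and the unit sphere of directions;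
  -- homogeneity then extends it to all vectors.
  obtain ⟨m, hm, hmG⟩ := ((isCompact_closedBall (f x).1 r).prod
    (isCompact_sphere (0 : Plane) 1)).exists_forall_le' (a := 0)
    (hGc.mono (prod_mono hball (subset_univ _)))
    (fun z hz ↦ hGpos _ (hball hz.1) _ (by
      rintro h0
      have := hz.2
      rw [h0] at this
      simp at this))
  have hquad : ∀ q ∈ Metric.closedBall (f x).1 r, ∀ v : Plane, m * ‖v‖ ^ 2 ≤ G (q, v) := by
    intro q hq v
    have hhom : ∀ (t : ℝ) (u : Plane), G (q, t • u) = t ^ 2 * G (q, u) := by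
      intro t u
      simp only [G, map_smul]
      exact spacetimeMetric_smul (q, h q) t (u, fderiv ℝ h q u)
    by_cases hv : v = 0
    · have h0 : G (q, 0) = 0 := by simpa using hhom 0 0
      simp [hv, h0]
    · have hv' : ‖v‖ ≠ 0 := norm_ne_zero_iff.2 hv
      have h1 : m ≤ G (q, ‖v‖⁻¹ • v) :=
        hmG (q, ‖v‖⁻¹ • v) ⟨hq, by simp [norm_smul, hv']⟩
      have h2 := hhom ‖v‖ (‖v‖⁻¹ • v)
      rw [smul_inv_smul₀ hv'] at h2
      rw [h2, mul_comm]
      gcongr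
  have hcont : ContinuousAt (fun y ↦ (f y).1) x := hp.contMDiff.continuous.continuousAt
  refine ⟨Real.sqrt m, Real.sqrt_pos.2 hm, ?_⟩
  filter_upwards [e.open_source.mem_nhds hx,
    hcont.preimage_mem_nhds (Metric.closedBall_mem_nhds _ hr)] with y hy hyb v
  rw [← hGeq y hy v]
  refine Real.le_sqrt_of_sq_le ?_
  rw [mul_pow, Real.sq_sqrt hm.le]
  exact hquad _ hyb _

end Spacelike

/-! ### Completeness, lifting of segments, and distances on surface and base -/

section Complete

variable {S : Type*} [TopologicalSpace S] [ChartedSpace Plane S]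
  {δ τ : Plane → ℝ} {f : S → Plane × ℝ} {n : WithTop ℕ∞} {U : Set Plane}

theorem sqrt_inducedMetric_base {p : S → Plane} (hδ_pos : ∀ x, 0 < δ (p x)) (x : S)
    (v : TangentSpace 𝓘(ℝ, Plane) x) :
    ENNReal.ofReal (Real.sqrt (inducedMetric (baseMetric δ) p x v v)) =
      ENNReal.ofReal ((δ (p x))⁻¹ *
        norm (E := Plane) (mfderiv 𝓘(ℝ, Plane) 𝓘(ℝ, Plane) p x v)) :=
  congrArg _ (sqrt_baseMetric_self (hδ_pos x) _)

theorem sqrt_inducedMetric_spacetime_le (hδ_pos : ∀ x, 0 < δ (f x).1)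
    (hf : MDifferentiable 𝓘(ℝ, Plane) 𝓘(ℝ, Plane × ℝ) f) (x : S)
    (v : TangentSpace 𝓘(ℝ, Plane) x) :
    ENNReal.ofReal (Real.sqrt (inducedMetric (spacetimeMetric δ τ) f x v v)) ≤
      ENNReal.ofReal ((δ (f x).1)⁻¹ * norm (E := Plane)
        (mfderiv 𝓘(ℝ, Plane) 𝓘(ℝ, Plane) (fun y ↦ (f y).1) x v)) :=
  (ENNReal.ofReal_le_ofReal (Real.sqrt_le_sqrt (inducedMetric_spacetime_le hf x v))).trans_eq
    (sqrt_inducedMetric_base (p := fun y ↦ (f y).1) hδ_pos x v)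

theorem inducedEDist_triangle {F : Type*} [NormedAddCommGroup F] [NormedSpace ℝ F]
    {g : F → F → F → ℝ} (hg : ∀ p (t : ℝ) v, g p (t • v) (t • v) = t ^ 2 * g p v v)
    (f : S → F) (x y z : S) :
    inducedEDist g f x z ≤ inducedEDist g f x y + inducedEDist g f y z := by
  let := inducedENorm g f
  have := inducedENorm_smulClass hg f
  exact riemannianEDist_triangle

theorem inducedEDist_comm {F : Type*} [NormedAddCommGroup F] [NormedSpace ℝ F]
    {g : F → F → F → ℝ} (hg : ∀ p (t : ℝ) v, g p (t • v) (t • v) = t ^ 2 * g p v v)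
    (f : S → F) (x y : S) :
    inducedEDist g f x y = inducedEDist g f y x := by
  let := inducedENorm g f
  have := inducedENorm_smulClass hg f
  exact riemannianEDist_comm

/-- Small balls for the induced distance of a spacelike surface are small neighborhoods. -/
theorem exists_inducedEDist_lt_subset [T2Space S] (hU : StarConvex ℝ 0 U)
    (hδ : ContinuousOn δ U) (hδ_pos : ∀ q ∈ U, 0 < δ q) (hτ : ContinuousOn τ U)
    (hn : 1 ≤ n) (hf : ContMDiff 𝓘(ℝ, Plane) 𝓘(ℝ, Plane × ℝ) n f)
    (hfU : ∀ x, (f x).1 ∈ U)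
    (hp : IsLocalDiffeomorph 𝓘(ℝ, Plane) 𝓘(ℝ, Plane) n (fun y ↦ (f y).1))
    (hs : IsRiemannianInduced (spacetimeMetric δ τ) f) {x : S} {u : Set S} (hu : u ∈ 𝓝 x) :
    ∃ r : ℝ≥0∞, 0 < r ∧ ∀ y, inducedEDist (spacetimeMetric δ τ) f x y < r → y ∈ u := by
  let := inducedENorm (spacetimeMetric δ τ) f
  have := inducedENorm_smulClass (spacetimeMetric_smul (δ := δ) (τ := τ)) f
  obtain ⟨c, hc, hb⟩ := exists_lower_bound_inducedMetric hU hδ hδ_pos hτ hn hf hfU hp hs x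
  exact exists_riemannianEDist_lt_subset hp hn hc
    (hb.mono fun y hy v ↦ ENNReal.ofReal_le_ofReal (hy v)) hu

/-- Segments of the base lift to a complete spacelike surface. -/
theorem exists_lift_segment [T2Space S] (hU : StarConvex ℝ 0 U)
    (hδ : ContinuousOn δ U) (hδ_pos : ∀ q ∈ U, 0 < δ q) (hτ : ContinuousOn τ U)
    (hn : 1 ≤ n) (hf : ContMDiff 𝓘(ℝ, Plane) 𝓘(ℝ, Plane × ℝ) n f)
    (hfU : ∀ x, (f x).1 ∈ U)
    (hp : IsLocalDiffeomorph 𝓘(ℝ, Plane) 𝓘(ℝ, Plane) n (fun y ↦ (f y).1))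
    (hs : IsRiemannianInduced (spacetimeMetric δ τ) f)
    (hcomp : IsCompleteInduced (spacetimeMetric δ τ) f)
    (x₀ : S) (q : Plane) (hq : segment ℝ (f x₀).1 q ⊆ U) :
    ∃ γ : ℝ → S, ContinuousOn γ (Icc 0 1) ∧ γ 0 = x₀ ∧
      ∀ t ∈ Icc (0 : ℝ) 1, (f (γ t)).1 = AffineMap.lineMap (f x₀).1 q t := by
  have hn0 : n ≠ 0 := (zero_lt_one.trans_le hn).ne'
  set c : ℝ → Plane := fun t ↦ AffineMap.lineMap (f x₀).1 q t
  have hc : Continuous c := AffineMap.lineMap_continuous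
  have hcU : MapsTo c (Icc 0 1) U := fun t ht ↦
    hq (by rw [segment_eq_image_lineMap]; exact ⟨t, ht, rfl⟩)
  obtain ⟨L, hL⟩ : ∃ L, ∀ t ∈ Icc (0 : ℝ) 1, (δ (c t))⁻¹ ≤ L := by
    have hcont : ContinuousOn (fun t ↦ (δ (c t))⁻¹) (Icc 0 1) :=
      (hδ.comp hc.continuousOn hcU).inv₀ fun t ht ↦ (hδ_pos _ (hcU ht)).ne'
    obtain ⟨L, hL⟩ := (isCompact_Icc.image_of_continuousOn hcont).bddAbove
    exact ⟨L, fun t ht ↦ hL ⟨t, ht, rfl⟩⟩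
  have hL0 : 0 ≤ L := (inv_nonneg.2 (hδ_pos _ (hcU (left_mem_Icc.2 zero_le_one))).le).trans
    (hL 0 (left_mem_Icc.2 zero_le_one))
  refine hp.isLocalHomeomorph.exists_lift_of_tendsto hc (by simp [c]) ?_
  intro T hT γ hγ hlift
  set K : ℝ := L * ‖q - (f x₀).1‖ with hK
  have hK0 : 0 ≤ K := by positivity
  set d := inducedEDist (spacetimeMetric δ τ) f with hd
  -- The lift is no longer than the segment it covers, and `L` bounds the conformal factor `δ⁻¹`
  -- along that segment.
  have hdist : ∀ a b, a ∈ Ico 0 T → b ∈ Ico 0 T → a ≤ b →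
      d (γ a) (γ b) ≤ ENNReal.ofReal (K * (b - a)) := by
    intro a b ha hb hab
    have hsub : Icc a b ⊆ Ico 0 T := fun t ht ↦ ⟨ha.1.trans ht.1, ht.2.trans_lt hb.2⟩
    let := inducedENorm (spacetimeMetric δ τ) f
    have := inducedENorm_smulClass (spacetimeMetric_smul (δ := δ) (τ := τ)) f
    exact riemannianEDist_le_of_lift_lineMap hp hn (w := fun q ↦ (δ q)⁻¹)
      (sqrt_inducedMetric_spacetime_le (fun x ↦ hδ_pos _ (hfU x)) (hf.mdifferentiable hn0)) hab
      (hγ.mono hsub) (fun t ht ↦ hlift t (hsub ht))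
      (fun t ht ↦ hL t ⟨(hsub ht).1, (hsub ht).2.le.trans hT.2⟩)
  have hdist' : ∀ a b, a ∈ Ico 0 T → b ∈ Ico 0 T →
      d (γ a) (γ b) ≤ ENNReal.ofReal (K * |b - a|) := by
    intro a b ha hb
    rcases le_total a b with h | h
    · rw [abs_of_nonneg (sub_nonneg.2 h)]
      exact hdist a b ha hb h
    · rw [abs_sub_comm, abs_of_nonneg (sub_nonneg.2 h), hd,
        inducedEDist_comm spacetimeMetric_smul]
      exact hdist b a hb ha h
  obtain ⟨s, -, hs_mem, hs_lim⟩ := exists_seq_strictMono_tendsto' hT.1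
  have hsI : ∀ k, s k ∈ Ico 0 T := fun k ↦ ⟨(hs_mem k).1.le, (hs_mem k).2⟩
  have hcauchy : ∀ ε : ℝ≥0∞, 0 < ε → ∃ N : ℕ, ∀ m ≥ N, ∀ k ≥ N, d (γ (s m)) (γ (s k)) < ε := by
    intro ε hε
    have h1 : Tendsto (fun z : ℕ × ℕ ↦ ENNReal.ofReal (K * |s z.2 - s z.1|)) atTop (𝓝 0) := by
      rw [← prod_atTop_atTop_eq]
      have h2 : Tendsto (fun z : ℕ × ℕ ↦ K * |s z.2 - s z.1|) (atTop ×ˢ atTop)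
          (𝓝 (K * |T - T|)) :=
        (((hs_lim.comp tendsto_snd).sub (hs_lim.comp tendsto_fst)).abs).const_mul K
      simpa using ENNReal.tendsto_ofReal h2
    obtain ⟨⟨N₁, N₂⟩, hN⟩ := eventually_atTop.1 (h1.eventually_lt_const hε)
    refine ⟨max N₁ N₂, fun m hm k hk ↦ (hdist' _ _ (hsI m) (hsI k)).trans_lt (hN (m, k) ?_)⟩
    exact ⟨(le_max_left _ _).trans hm, (le_max_right _ _).trans hk⟩
  obtain ⟨x, hx⟩ := hcomp (fun k ↦ γ (s k)) hcauchy
  -- Only a sequence `γ (s k)` is known to converge, and only in distance. For `t` between `s k` and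
  -- `T` the Lipschitz bound `K * (T - s k)` controls the rest of the path, and small distance balls
  -- lie in `u`.
  refine ⟨x, fun u hu ↦ ?_⟩
  obtain ⟨r, hr, hru⟩ := exists_inducedEDist_lt_subset hU hδ hδ_pos hτ hn hf hfU hp hs hu
  have hr2 : 0 < r / 2 := ENNReal.half_pos hr.ne'
  have hKlim : Tendsto (fun k ↦ ENNReal.ofReal (K * (T - s k))) atTop (𝓝 0) := by
    have h2 : Tendsto (fun k ↦ K * (T - s k)) atTop (𝓝 (K * (T - T))) :=
      (tendsto_const_nhds.sub hs_lim).const_mul K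
    simpa using ENNReal.tendsto_ofReal h2
  obtain ⟨k, hk1, hk2⟩ :=
    ((hx.eventually_lt_const hr2).and (hKlim.eventually_lt_const hr2)).exists
  rw [mem_map]
  filter_upwards [Ioo_mem_nhdsLT (hs_mem k).2] with t ht
  have htI : t ∈ Ico 0 T := ⟨(hsI k).1.trans ht.1.le, ht.2⟩
  apply hru
  rw [inducedEDist_comm spacetimeMetric_smul]
  calc d (γ t) x ≤ d (γ t) (γ (s k)) + d (γ (s k)) x :=
        inducedEDist_triangle spacetimeMetric_smul f _ _ _
    _ < r / 2 + r / 2 := by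
        refine ENNReal.add_lt_add (lt_of_le_of_lt ?_ hk2) hk1
        refine (hdist' _ _ htI (hsI k)).trans (ENNReal.ofReal_le_ofReal ?_)
        rw [abs_sub_comm, abs_of_nonneg (sub_nonneg.2 ht.1.le)]
        gcongr
        exact ht.2.le
    _ = r := ENNReal.add_halves r

/-- Convergence in an open subset of the plane implies convergence for the distance of the
conformal metric `δ⁻² (dx² + dy²)`. -/
theorem tendsto_inducedEDist_base {Ω : TopologicalSpace.Opens Plane}
    (hδ : ContinuousOn δ Ω) (hδ_pos : ∀ q ∈ Ω, 0 < δ q) {ι : Type*} {l : Filter ι} {a : ι → Ω}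
    {q : Ω} (ha : Tendsto a l (𝓝 q)) :
    Tendsto (fun i ↦ inducedEDist (baseMetric δ) (Subtype.val : Ω → Plane) (a i) q) l (𝓝 0) := by
  have hqδ : 0 < δ q := hδ_pos q q.2
  have hnear : ∀ᶠ z in 𝓝 (q : Plane), z ∈ Ω ∧ (δ z)⁻¹ < (δ q)⁻¹ + 1 := by
    have hcont : ContinuousAt (fun z ↦ (δ z)⁻¹) (q : Plane) :=
      (hδ.continuousAt (Ω.isOpen.mem_nhds q.2)).inv₀ hqδ.ne'
    exact (Ω.isOpen.eventually_mem q.2).and (hcont.eventually_lt_const (lt_add_one _))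
  obtain ⟨r, hr, hball⟩ := Metric.eventually_nhds_iff_ball.1 hnear
  have hval : Tendsto (fun i ↦ (a i : Plane)) l (𝓝 (q : Plane)) :=
    (continuous_subtype_val.tendsto q).comp ha
  have hlim : Tendsto (fun i ↦ ENNReal.ofReal (((δ q)⁻¹ + 1) * ‖(q : Plane) - a i‖ * (1 - 0))) l
      (𝓝 0) := by
    have h2 : Tendsto (fun i ↦ ((δ q)⁻¹ + 1) * ‖(q : Plane) - a i‖ * (1 - 0)) l
        (𝓝 (((δ q)⁻¹ + 1) * ‖(q : Plane) - q‖ * (1 - 0))) :=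
      ((tendsto_const_nhds.sub hval).norm.const_mul _).mul_const _
    simpa using ENNReal.tendsto_ofReal h2
  refine tendsto_of_tendsto_of_tendsto_of_le_of_le' tendsto_const_nhds hlim
    (Eventually.of_forall fun _ ↦ zero_le) ?_
  filter_upwards [hval.eventually_mem (Metric.ball_mem_nhds _ hr)] with i hi
  have hseg : ∀ t ∈ Icc (0 : ℝ) 1, AffineMap.lineMap (a i : Plane) (q : Plane) t ∈
      Metric.ball (q : Plane) r := fun t ht ↦
    (convex_ball (q : Plane) r).segment_subset hi (Metric.mem_ball_self hr)
      (by rw [segment_eq_image_lineMap]; exact ⟨t, ht, rfl⟩)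
  -- Clamping the parameter keeps the segment inside `Ω` for every real `t`, as a path in the
  -- subtype requires.
  let γ : ℝ → Ω := fun t ↦
    ⟨AffineMap.lineMap (a i : Plane) (q : Plane) (projIcc (0 : ℝ) 1 zero_le_one t : ℝ),
      (hball _ (hseg _ (projIcc (0 : ℝ) 1 zero_le_one t).2)).1⟩
  have hγ : Continuous γ := by
    refine Continuous.subtype_mk ?_ _
    exact (AffineMap.lineMap_continuous (R := ℝ)).comp
      (continuous_subtype_val.comp continuous_projIcc)
  have hγeq : ∀ t ∈ Icc (0 : ℝ) 1, (γ t : Plane) = AffineMap.lineMap (a i : Plane) (q : Plane) t :=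
    fun t ht ↦ by simp [γ, projIcc_of_mem zero_le_one ht]
  let := inducedENorm (baseMetric δ) (Subtype.val : Ω → Plane)
  have := inducedENorm_smulClass (baseMetric_smul (δ := δ)) (Subtype.val : Ω → Plane)
  have hmain := riemannianEDist_le_of_lift_lineMap
    (Ω.isLocalDiffeomorph_subtype_val (n := 1)) le_rfl (w := fun q ↦ (δ q)⁻¹)
    (fun x v ↦ (sqrt_inducedMetric_base (fun x ↦ hδ_pos _ x.2) x v).le) zero_le_one
    hγ.continuousOn hγeq (L := (δ q)⁻¹ + 1) (fun t ht ↦ (hball _ (hseg t ht)).2.le)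
  have h0 : γ 0 = a i := Subtype.ext (by simp [hγeq 0 (by simp)])
  have h1 : γ 1 = q := Subtype.ext (by simp [hγeq 1 (by simp)])
  rw [h0, h1] at hmain
  exact hmain

/-- A continuous section of a spacelike surface over the base does not increase distances. -/
theorem inducedEDist_section_le {Ω : TopologicalSpace.Opens Plane} (hδ_pos : ∀ q ∈ Ω, 0 < δ q)
    (hn : 1 ≤ n) (hf : ContMDiff 𝓘(ℝ, Plane) 𝓘(ℝ, Plane × ℝ) n f)
    (hfΩ : ∀ x, (f x).1 ∈ Ω)
    (hp : IsLocalDiffeomorph 𝓘(ℝ, Plane) 𝓘(ℝ, Plane) n (fun y ↦ (f y).1))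
    {σ : Ω → S} (hσ : Continuous σ) (hpσ : ∀ q, (f (σ q)).1 = q) (a b : Ω) :
    inducedEDist (spacetimeMetric δ τ) f (σ a) (σ b) ≤
      inducedEDist (baseMetric δ) (Subtype.val : Ω → Plane) a b := by
  have hn0 : n ≠ 0 := (zero_lt_one.trans_le hn).ne'
  have hval := Ω.isLocalDiffeomorph_subtype_val (n := 1)
  refine le_of_forall_gt fun r hr ↦ ?_
  -- An almost minimizing base path `c`; its lift `σ ∘ c` joins `σ a` to `σ b` and is no longer.
  obtain ⟨c, hca, hcb, hcC, hlen⟩ : ∃ c : ℝ → Ω, c 0 = a ∧ c 1 = b ∧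
      ContMDiff 𝓘(ℝ, ℝ) 𝓘(ℝ, Plane) 1 c ∧
      ∫⁻ t in Ioo (0 : ℝ) 1, ENNReal.ofReal ((δ (c t))⁻¹ *
        ‖deriv ((Subtype.val : Ω → Plane) ∘ c) t‖) < r := by
    let := inducedENorm (baseMetric δ) (Subtype.val : Ω → Plane)
    have := inducedENorm_smulClass (baseMetric_smul (δ := δ)) (Subtype.val : Ω → Plane)
    obtain ⟨c, hca, hcb, hcC, hlen, -⟩ :=
      exists_lt_locally_constant_of_riemannianEDist_lt (I := 𝓘(ℝ, Plane)) hr zero_lt_one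
    refine ⟨c, hca, hcb, hcC, ?_⟩
    rwa [pathELength_eq_lintegral_of_enorm_eq hval le_rfl (w := fun q ↦ (δ q)⁻¹)
      (fun x v ↦ sqrt_inducedMetric_base (fun x ↦ hδ_pos _ x.2) x v) hcC.contMDiffOn] at hlen
  refine lt_of_le_of_lt ?_ hlen
  have hcomp : (fun y ↦ (f y).1) ∘ (σ ∘ c) = (Subtype.val : Ω → Plane) ∘ c := by
    ext1 t
    exact hpσ (c t)
  let := inducedENorm (spacetimeMetric δ τ) f
  have := inducedENorm_smulClass (spacetimeMetric_smul (δ := δ) (τ := τ)) f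
  have hmain := riemannianEDist_le_lintegral_of_lift hp hn (w := fun q ↦ (δ q)⁻¹)
    (sqrt_inducedMetric_spacetime_le (τ := τ) (fun x ↦ hδ_pos _ (hfΩ x)) (hf.mdifferentiable hn0))
    zero_le_one (hσ.comp hcC.continuous).continuousOn
    (by rw [hcomp]; exact (contMDiff_iff_contDiff.1 (hval.contMDiff.comp hcC)).contDiffOn)
  rw [hcomp] at hmain
  simp only [Function.comp_apply, hca, hcb, hpσ] at hmain
  exact hmain

end Complete

end

/-! ### The entire graph and completeness of the base -/

theorem lemma4p2
    (Ω : TopologicalSpace.Opens Plane) (hΩ : StarConvex ℝ 0 (Ω : Set Plane))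
    (δ τ : Plane → ℝ)
    (hδ : ContDiffOn ℝ ∞ δ Ω) (hδ_pos : ∀ p ∈ Ω, 0 < δ p)
    (hτ : ContDiffOn ℝ 2 τ Ω)
    (n : ℕ∞) (hn : 1 ≤ n)
    {S : Type*} [TopologicalSpace S] [T2Space S] [ConnectedSpace S]
    [ChartedSpace Plane S] [IsManifold 𝓘(ℝ, Plane) n S]
    (f : S → Plane × ℝ)
    (hf : ContMDiff 𝓘(ℝ, Plane) 𝓘(ℝ, Plane × ℝ) n f)
    (hfΩ : ∀ x, (f x).1 ∈ Ω)
    (hf_spacelike : IsRiemannianInduced (spacetimeMetric δ τ) f)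
    (hf_complete : IsCompleteInduced (spacetimeMetric δ τ) f) :
    IsEntireGraph (Ω : Set Plane) n f ∧ IsCompleteBase Ω δ := by
  have hn' : (1 : WithTop ℕ∞) ≤ n := by exact_mod_cast hn
  have hp := isLocalDiffeomorph_fst hn' hf hf_spacelike
  obtain ⟨hinj, hrange⟩ := hp.isLocalHomeomorph.injective_and_range_eq_of_starConvex hΩ hfΩ
    (exists_lift_segment hΩ hδ.continuousOn hδ_pos hτ.continuousOn hn' hf hfΩ hp hf_spacelike
      hf_complete)
  have hemb := hp.isLocalHomeomorph.isOpenEmbedding_of_injective hinj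
  have hsurj : ∀ q : Ω, ∃ x, (f x).1 = q := fun q ↦ by
    have : (q : Plane) ∈ range fun y ↦ (f y).1 := by rw [hrange]; exact q.2
    exact this
  choose σ hσ using hsurj
  have hσf : ∀ x, σ ⟨(f x).1, hfΩ x⟩ = x := fun x ↦ hinj (hσ _)
  have hσc : Continuous σ := by
    rw [hemb.isInducing.continuous_iff]
    exact continuous_subtype_val.congr fun q ↦ (hσ q).symm
  -- `f` is an embedding because its composite with the first projection already is.
  refine ⟨⟨.of_comp hf.continuous continuous_fst hemb.isEmbedding, ?_⟩, fun a ha ↦ ?_⟩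
  · classical
    let u : Plane → ℝ := fun q ↦ if h : q ∈ Ω then (f (σ ⟨q, h⟩)).2 else 0
    have hu : ∀ x, u (f x).1 = (f x).2 := fun x ↦ by simp [u, hfΩ x, hσf]
    refine ⟨u, fun q hq ↦ ?_, ?_⟩
    -- Near `q` the function `u` coincides with the height over the local inverse `e.symm`, which
    -- carries the `C^n` regularity; the section `σ` is only known to be continuous.
    · obtain ⟨e, hx, hpe, he⟩ := hp.exists_openPartialHomeomorph (σ ⟨q, hq⟩)
      have hqt : q ∈ e.target := by
        have := e.map_source hx
        rw [← hpe hx] at this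
        simpa [hσ] using this
      refine ContDiffAt.contDiffWithinAt (((contDiffOn_graph hf he).contDiffAt
        (e.open_target.mem_nhds hqt)).congr_of_eventuallyEq ?_)
      filter_upwards [e.open_target.mem_nhds hqt] with z hz
      have hz' : (f (e.symm z)).1 = z := (hpe (e.map_target hz)).trans (e.right_inv hz)
      rw [← hu, hz']
    · ext z
      constructor
      · rintro ⟨x, rfl⟩
        exact ⟨hfΩ x, (hu x).symm⟩
      · rintro ⟨hz, hz2⟩
        refine ⟨σ ⟨z.1, hz⟩, Prod.ext (hσ _) ?_⟩
        rw [hz2, ← hu, hσ]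
  · obtain ⟨x, hx⟩ := hf_complete (fun k ↦ σ (a k)) fun ε hε ↦ by
      obtain ⟨N, hN⟩ := ha ε hε
      exact ⟨N, fun m hm k hk ↦
        (inducedEDist_section_le hδ_pos hn' hf hfΩ hp hσc hσ _ _).trans_lt (hN m hm k hk)⟩
    have hlim : Tendsto (fun k ↦ σ (a k)) atTop (𝓝 x) := by
      intro u hu
      obtain ⟨r, hr, hru⟩ := exists_inducedEDist_lt_subset hΩ hδ.continuousOn hδ_pos
        hτ.continuousOn hn' hf hfΩ hp hf_spacelike hu
      rw [mem_map]
      filter_upwards [hx.eventually_lt_const hr] with k hk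
      exact hru _ (by rwa [inducedEDist_comm spacetimeMetric_smul])
    -- Projecting the limit gives convergence in the topology of `Ω`, which implies convergence for
    -- the conformal distance.
    refine ⟨⟨(f x).1, hfΩ x⟩, tendsto_inducedEDist_base hδ.continuousOn hδ_pos ?_⟩
    rw [tendsto_subtype_rng]
    refine ((hp.contMDiff.continuous.tendsto x).comp hlim).congr fun k ↦ ?_
    exact hσ (a k)
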